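/- Let $c_0$ be the real Banach space of real null sequences with the supremum norm, and let $X = c_0 \oplus_2 c_0$, i.e. $c_0\times c_0$ with the norm $\|(x,y)\| = (\|x\|^2+\|y\|^2)^{1/2}$. Regard every normed space as a subspace of its bidual through the canonical embedding. Then the following hold. 1. $X$ is a strict u-ideal in its bidual: $X^{***} = X^{\perp}\oplus X^{*}$, where $X^\perp\subseteq X^{***}$ is the annihilator of $X\subseteq X^{**}$, and $\|x+z\|=\|x-z\|$ for all $x\in X^\perp$, $z\in X^*$. 2. $X$ has the diameter 2 property: every nonempty relatively weakly open subset of the closed unit ball of $X$ has diameter $2$. 3. $X^*$ is not an $L$-summand in $X^{***}$: there is no subspace $Z$ of $X^{***}$ with $X^{***}=X^*\oplus Z$ and $\|x+z\|=\|x\|+\|z\|$ for all $x\in X^*$, $z\in Z$. 4. $\sup_{n\ge 0}\dim Z(X^{(2n)})=1$. Here $X^{(0)}=X$, $X^{(2n+2)}=(X^{(2n)})^{**}$, and the centralizer $Z(Y)$ of a real Banach space $Y$ is the space of bounded operators $T$ on $Y$ for which every extreme point $p$ of the unit ball of $Y^*$ satisfies $p\circ T = a_T(p)\,p$ for some scalar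 $a_T(p)$, and for which there is a bounded operator $S$ on $Y$ with $p\circ S = \overline{a_T(p)}\,p$ for all such $p$ (for real scalars one may take $S=T$). 5. $X$ is not a uniform algebra: for $\mathbb K=\mathbb R$ and for $\mathbb K=\mathbb C$, $X$ is not isometrically isomorphic, as a real Banach space, to a closed subalgebra of $C(K,\mathbb K)$, $K$ compact Hausdorff, that contains the constants and separates the points of $K$. 6. $X$ lacks the Daugavet property: there is a bounded operator $T:X\to X$ of rank one with $\|I+T\|\ne 1+\|T\|$. -/

import Mathlib

set_option maxSynthPendingDepth 3

open scoped ZeroAtInfty ENNReal ComplexConjugate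

noncomputable section

universe u

/-- The real Banach space `c₀ ⊕₂ c₀`; `C₀(ℕ, ℝ)` is the space of real null sequences
with the supremum norm. -/
abbrev CZeroSumTwo : Type := WithLp 2 (C₀(ℕ, ℝ) × C₀(ℕ, ℝ))

section Summands

variable (Y : Type u) [NormedAddCommGroup Y] [NormedSpace ℝ Y]

/-- `N` is an L-complement of `M` in `Y`: `Y = M ⊕ N` and `‖x + z‖ = ‖x‖ + ‖z‖`. -/
def IsLComplement (M N : Submodule ℝ Y) : Prop :=
  IsCompl M N ∧ ∀ x ∈ M, ∀ z ∈ N, ‖x + z‖ = ‖x‖ + ‖z‖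

/-- `M` is an L-summand in `Y`. -/
def IsLSummand (M : Submodule ℝ Y) : Prop :=
  ∃ N : Submodule ℝ Y, IsLComplement Y M N

/-- `N` is a u-complement of `M` in `Y`: `Y = M ⊕ N` and `‖x + z‖ = ‖x - z‖`. -/
def IsUComplement (M N : Submodule ℝ Y) : Prop :=
  IsCompl M N ∧ ∀ x ∈ M, ∀ z ∈ N, ‖x + z‖ = ‖x - z‖

/-- `M` is a u-summand in `Y`. -/
def IsUSummand (M : Submodule ℝ Y) : Prop :=
  ∃ N : Submodule ℝ Y, IsUComplement Y M N

/-- The annihilator of `M` in the dual of `Y`, that is, the functionals vanishing on `M`. -/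
abbrev annihilator (M : Submodule ℝ Y) : Submodule ℝ (StrongDual ℝ Y) :=
  StrongDual.polarSubmodule ℝ M

/-- `M` is a u-ideal in `Y`: its annihilator is a u-summand in the dual of `Y`. -/
def IsUIdeal (M : Submodule ℝ Y) : Prop :=
  IsUSummand (StrongDual ℝ Y) (annihilator Y M)

end Summands

section Properties

variable (X : Type u) [NormedAddCommGroup X] [NormedSpace ℝ X]

/-- The canonical copy of `X` in its bidual. -/
def canonicalImage : Submodule ℝ (StrongDual ℝ (StrongDual ℝ X)) :=
  (NormedSpace.inclusionInDoubleDual ℝ X).range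

/-- `X` is a strict u-ideal in its bidual: `X` is a u-ideal in `X**` and the u-complement of
`X^⊥` in `X***` is the canonical copy of `X*`. -/
def IsStrictUIdealInBidual : Prop :=
  IsUIdeal (StrongDual ℝ (StrongDual ℝ X)) (canonicalImage X) ∧
    IsUComplement (StrongDual ℝ (StrongDual ℝ (StrongDual ℝ X)))
      (annihilator (StrongDual ℝ (StrongDual ℝ X)) (canonicalImage X))
      (canonicalImage (StrongDual ℝ X))

/-- The diameter 2 property: every nonempty relatively weakly open subset of the closed unit ball
has diameter 2. -/
def HasDiameterTwoProperty : Prop :=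
  ∀ U : Set (WeakSpace ℝ X), IsOpen U →
    (toWeakSpace ℝ X ⁻¹' U ∩ Metric.closedBall (0 : X) 1).Nonempty →
      Metric.diam (toWeakSpace ℝ X ⁻¹' U ∩ Metric.closedBall (0 : X) 1) = 2

/-- The Daugavet property: `‖I + T‖ = 1 + ‖T‖` for every bounded operator `T` of rank one. -/
def HasDaugavetProperty : Prop :=
  ∀ T : X →L[ℝ] X, LinearMap.rank (T : X →ₗ[ℝ] X) = 1 →
    ‖ContinuousLinearMap.id ℝ X + T‖ = 1 + ‖T‖

/-- The real normed space `X` is a uniform algebra with scalars `𝕜`: it is isometrically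
isomorphic, over `ℝ`, to a closed subalgebra of some `C(K, 𝕜)`, `K` compact Hausdorff, which
contains the constants (subalgebras are unital) and separates the points of `K`. -/
def IsUniformAlgebra (𝕜 : Type) [RCLike 𝕜] : Prop :=
  ∃ (K : Type u) (_ : TopologicalSpace K) (_ : CompactSpace K) (_ : T2Space K)
    (A : Subalgebra 𝕜 C(K, 𝕜)),
    IsClosed (A : Set C(K, 𝕜)) ∧ A.SeparatesPoints ∧
      ∃ φ : X →ₗᵢ[ℝ] C(K, 𝕜), Set.range φ = (A : Set C(K, 𝕜))

/-- The extreme points of the closed unit ball of the dual of `X`. -/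
def dualExtremePoints : Set (StrongDual ℝ X) :=
  Set.extremePoints ℝ (Metric.closedBall (0 : StrongDual ℝ X) 1)

/-- The centralizer of `X`. A multiplier is a bounded operator `T` such that each extreme point
`p` of the dual ball satisfies `p ∘ T = a_T(p) p` for a scalar `a_T(p)`; the centralizer consists
of the multipliers `T` for which there is a multiplier `S` with `a_S(p) = conj (a_T(p))` for all
such `p`. -/
def centralizer : Submodule ℝ (X →L[ℝ] X) where
  carrier := {T | ∃ S : X →L[ℝ] X, ∀ p ∈ dualExtremePoints X,
    ∃ a : ℝ, p.comp T = a • p ∧ p.comp S = conj a • p}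
  zero_mem' := ⟨0, fun p _ => ⟨0, by simp, by simp⟩⟩
  add_mem' := by
    rintro T₁ T₂ ⟨S₁, h₁⟩ ⟨S₂, h₂⟩
    refine ⟨S₁ + S₂, fun p hp => ?_⟩
    obtain ⟨a, ha, ha'⟩ := h₁ p hp
    obtain ⟨b, hb, hb'⟩ := h₂ p hp
    exact ⟨a + b, by rw [ContinuousLinearMap.comp_add, ha, hb, add_smul],
      by rw [ContinuousLinearMap.comp_add, ha', hb', map_add, add_smul]⟩
  smul_mem' := by
    rintro c T ⟨S, h⟩
    refine ⟨conj c • S, fun p hp => ?_⟩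
    obtain ⟨a, ha, ha'⟩ := h p hp
    exact ⟨c * a, by rw [ContinuousLinearMap.comp_smul, ha, smul_smul],
      by rw [ContinuousLinearMap.comp_smul, ha', map_mul, smul_smul]⟩

end Properties

/-- A real normed space, bundled. -/
structure RealNormedSpace where
  carrier : Type u
  [group : NormedAddCommGroup carrier]
  [space : NormedSpace ℝ carrier]

attribute [instance] RealNormedSpace.group RealNormedSpace.space

/-- The even dual `X^{(2n)}`: `X^{(0)} = X` and `X^{(2n+2)}` is the bidual of `X^{(2n)}`. -/
def evenDual (X : Type u) [NormedAddCommGroup X] [NormedSpace ℝ X] : ℕ → RealNormedSpace.{u}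
  | 0 => ⟨X⟩
  | n + 1 => ⟨StrongDual ℝ (StrongDual ℝ (evenDual X n).carrier)⟩

end

/-! Items 3 and 4 come from the coordinate projection `P` of `X` onto the first summand, for which
`‖y‖² = ‖P y‖² + ‖y - P y‖²`. This identity passes to transposes (`IsL2Projection.transpose`), hence
to every higher dual. If `p`, `q` are nonzero extreme functionals of the two parts of the dual ball,
then `s p + t q` is extreme whenever `s, t ≥ 0` and `s² + t² = 1`. A multiplier therefore has the
same eigenvalue at `p` and `q`, and is scalar because such functionals separate points. For item 3,
additivity of the norm forces any L-complement of `X*` to lie in the range of the projection and in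
its kernel, hence to be zero, whereas `X* ≠ X***` because `X` is not reflexive.

The other items use `c₀` itself. Truncations `T n` have finite rank, satisfy `‖I - 2 T n‖ ≤ 1`, and
their transposes converge strongly to the identity. The third transpose of `I - 2 T n` thus carries
`F + f`, with `F ∈ X^⊥` and `f ∈ X*`, towards `F - f`. Far coordinates can be altered with little
effect on weak neighbourhoods or on the sup norm; this gives diameter 2 and excludes an algebra
unit, for which the scalar parallelogram law would hold at a point. Deleting one coordinate refutes
the Daugavet property. -/

noncomputable section

/-! ### L²-projections, transposes, and extreme functionals -/

section L2Projection

/-- The transpose of a bounded operator, as an operator between the dual spaces. -/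
abbrev transpose {X Y : Type*} [NormedAddCommGroup X] [NormedSpace ℝ X]
    [NormedAddCommGroup Y] [NormedSpace ℝ Y] (T : X →L[ℝ] Y) :
    StrongDual ℝ Y →L[ℝ] StrongDual ℝ X :=
  ContinuousLinearMap.precomp ℝ T

theorem norm_transpose_le {X Y : Type*} [NormedAddCommGroup X] [NormedSpace ℝ X]
    [NormedAddCommGroup Y] [NormedSpace ℝ Y] (T : X →L[ℝ] Y) : ‖transpose T‖ ≤ ‖T‖ :=
  ContinuousLinearMap.opNorm_le_bound _ (norm_nonneg _) fun f => by
    rw [mul_comm]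
    exact f.opNorm_comp_le T

/-- `P` is a projection for which `‖y‖² = ‖P y‖² + ‖y - P y‖²`. -/
structure IsL2Projection {Y : Type*} [NormedAddCommGroup Y] [NormedSpace ℝ Y]
    (P : Y →L[ℝ] Y) : Prop where
  idem : ∀ y, P (P y) = P y
  norm_sq : ∀ y, ‖y‖ ^ 2 = ‖P y‖ ^ 2 + ‖y - P y‖ ^ 2

variable {Y : Type*} [NormedAddCommGroup Y] [NormedSpace ℝ Y] {P : Y →L[ℝ] Y}

theorem exists_norm_le_one_mul_norm_le_apply (f : StrongDual ℝ Y) {c : ℝ} (hc : c < 1) :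
    ∃ y, ‖y‖ ≤ 1 ∧ c * ‖f‖ ≤ f y := by
  rcases (norm_nonneg f).eq_or_lt with hf | hf
  · exact ⟨0, by simp [← hf]⟩
  · obtain ⟨y, hy, hfy⟩ := f.exists_lt_apply_of_lt_opNorm (r := c * ‖f‖) (by nlinarith)
    rcases le_total 0 (f y) with h | h
    · exact ⟨y, hy.le, (hfy.trans_eq (Real.norm_of_nonneg h)).le⟩
    · refine ⟨-y, by simpa using hy.le, ?_⟩
      rw [map_neg]
      exact (hfy.trans_eq (Real.norm_of_nonpos h)).le

namespace IsL2Projection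

theorem compl (h : IsL2Projection P) : IsL2Projection (ContinuousLinearMap.id ℝ Y - P) where
  idem y := by simp [h.idem]
  norm_sq y := by
    have := h.norm_sq y
    simp only [sub_apply, ContinuousLinearMap.id_apply, sub_sub_cancel]
    linarith

theorem norm_apply_le (h : IsL2Projection P) (y : Y) : ‖P y‖ ≤ ‖y‖ := by
  have := h.norm_sq y
  rw [← sq_le_sq₀ (norm_nonneg _) (norm_nonneg _)]
  nlinarith [sq_nonneg ‖y - P y‖]

theorem opNorm_le (h : IsL2Projection P) : ‖P‖ ≤ 1 :=
  P.opNorm_le_bound zero_le_one fun y => by simpa using h.norm_apply_le y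

theorem norm_add_sq (h : IsL2Projection P) {u v : Y} (hu : P u = u) (hv : P v = 0) :
    ‖u + v‖ ^ 2 = ‖u‖ ^ 2 + ‖v‖ ^ 2 := by
  have := h.norm_sq (u + v)
  simpa [hu, hv] using this

/-- The transpose of an `L²`-projection is an `L²`-projection. -/
theorem transpose (h : IsL2Projection P) : IsL2Projection (transpose P) where
  idem f := by
    ext y
    simp [h.idem]
  norm_sq f := by
    set g : StrongDual ℝ Y := f.comp P with hg
    set k : StrongDual ℝ Y := f - f.comp P with hk
    change ‖f‖ ^ 2 = ‖g‖ ^ 2 + ‖k‖ ^ 2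
    have hgP : ∀ y, g (P y) = g y := fun y => by simp [hg, h.idem]
    have hkP : ∀ y, k (y - P y) = k y := fun y => by simp [hk, h.idem]
    have hkP0 : ∀ y, k (P y) = 0 := fun y => by simp [hk, h.idem]
    have hf : ∀ y, f y = g y + k y := fun y => by simp [hg, hk]
    have hQ := Real.sq_sqrt (by positivity : 0 ≤ ‖g‖ ^ 2 + ‖k‖ ^ 2)
    have hR := Real.sqrt_nonneg (‖g‖ ^ 2 + ‖k‖ ^ 2)
    set R := √(‖g‖ ^ 2 + ‖k‖ ^ 2)
    rw [← hQ, sq_eq_sq₀ (norm_nonneg _) hR]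
    apply le_antisymm
    · refine f.opNorm_le_bound hR fun y => ?_
      have h1 : ‖f y‖ ≤ ‖g‖ * ‖P y‖ + ‖k‖ * ‖y - P y‖ := by
        rw [hf, ← hgP, ← hkP]
        exact (norm_add_le _ _).trans (add_le_add (g.le_opNorm _) (k.le_opNorm _))
      refine h1.trans ?_
      rw [← sq_le_sq₀ (by positivity) (by positivity), mul_pow, hQ, h.norm_sq y]
      -- Cauchy–Schwarz in the plane.
      nlinarith [sq_nonneg (‖g‖ * ‖y - P y‖ - ‖k‖ * ‖P y‖)]
    -- The lower bound tests `f` on almost norming vectors of the two parts, weighted by `‖g‖` and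
    -- `‖k‖`. The factor `c < 1` is needed because norms may not be attained.
    · have key : ∀ c < 1, c * R ^ 2 ≤ ‖f‖ * R := by
        intro c hc
        obtain ⟨u, hu, hcu⟩ := exists_norm_le_one_mul_norm_le_apply g hc
        obtain ⟨v, hv, hcv⟩ := exists_norm_le_one_mul_norm_le_apply k hc
        set y := ‖g‖ • P u + ‖k‖ • (v - P v) with hy
        have hfy : f y = ‖g‖ * g u + ‖k‖ * k v := by
          have hg0 : g (v - P v) = 0 := by rw [map_sub, hgP, sub_self]
          rw [hf, hy]
          simp [-map_sub, hg0, hkP, hgP, hkP0]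
        have hny : ‖y‖ ≤ R := by
          rw [← sq_le_sq₀ (norm_nonneg _) hR, hQ, hy,
            h.norm_add_sq (by simp [h.idem]) (by simp [h.idem]), norm_smul, norm_smul, norm_norm,
            norm_norm]
          have h1 : ‖P u‖ ≤ 1 := (h.norm_apply_le u).trans hu
          have h2 : ‖v - P v‖ ≤ 1 := (h.compl.norm_apply_le v).trans hv
          gcongr
          · exact mul_le_of_le_one_right (norm_nonneg _) h1
          · exact mul_le_of_le_one_right (norm_nonneg _) h2
        calc c * R ^ 2 = ‖g‖ * (c * ‖g‖) + ‖k‖ * (c * ‖k‖) := by rw [hQ]; ring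
          _ ≤ ‖g‖ * g u + ‖k‖ * k v := by gcongr
          _ = f y := hfy.symm
          _ ≤ ‖f‖ * ‖y‖ := (le_abs_self _).trans (f.le_opNorm y)
          _ ≤ ‖f‖ * R := by gcongr
      by_contra! hlt
      have hR0 : 0 < R := (norm_nonneg f).trans_lt hlt
      obtain ⟨c, hc, hc1⟩ := exists_between ((div_lt_one hR0).2 hlt)
      have := key c hc1
      rw [div_lt_iff₀ hR0] at hc
      nlinarith

end IsL2Projection

/-- The functionals of norm at most one that are invariant under composition with `P`. -/
def invariantDualBall (P : Y →L[ℝ] Y) : Set (StrongDual ℝ Y) :=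
  {f | ‖f‖ ≤ 1 ∧ f.comp P = f}

/-- Krein–Milman in the weak* topology: if all extreme points vanished at `w`, so would the whole
compact convex set, including `g.comp P` for a Hahn–Banach functional `g` norming `P w`. -/
theorem exists_extremePoint_invariantDualBall_apply_ne_zero (hP : IsL2Projection P) {w : Y}
    (hw : P w ≠ 0) : ∃ f ∈ (invariantDualBall P).extremePoints ℝ, f w ≠ 0 := by
  by_contra! H
  let B : Set (WeakDual ℝ Y) := WeakDual.toStrongDual ⁻¹' invariantDualBall P
  have hBclosed : IsClosed {f : WeakDual ℝ Y | ∀ y, f (P y) = f y} := by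
    rw [Set.ext fun f => show f ∈ {f : WeakDual ℝ Y | ∀ y, f (P y) = f y} ↔
      f ∈ ⋂ y, {f : WeakDual ℝ Y | f (P y) = f y} by simp]
    exact isClosed_iInter fun y =>
      isClosed_eq (WeakDual.eval_continuous _) (WeakDual.eval_continuous _)
  have hB : B = WeakDual.toStrongDual ⁻¹' Metric.closedBall 0 1 ∩
      {f : WeakDual ℝ Y | ∀ y, f (P y) = f y} := by
    ext f
    simp only [B, invariantDualBall, Set.mem_preimage, Set.mem_ofPred_eq, Set.mem_inter_iff,
      mem_closedBall_zero_iff]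
    refine and_congr_right fun _ => ⟨fun h y => DFunLike.congr_fun h y, fun h => ?_⟩
    exact ContinuousLinearMap.ext h
  have hBcomp : IsCompact B := by
    rw [hB]
    exact (WeakDual.isCompact_closedBall 0 1).inter_right hBclosed
  have hBconv : Convex ℝ B := by
    intro f hf g hg a b ha hb hab
    refine ⟨?_, ?_⟩
    · exact (convex_closedBall (0 : StrongDual ℝ Y) 1) (mem_closedBall_zero_iff.2 hf.1)
        (mem_closedBall_zero_iff.2 hg.1) ha hb hab |> mem_closedBall_zero_iff.1
    · have h1 := hf.2
      have h2 := hg.2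
      rw [map_add, map_smul, map_smul, ContinuousLinearMap.add_comp, ContinuousLinearMap.smul_comp,
        ContinuousLinearMap.smul_comp, h1, h2]
  have : LocallyConvexSpace ℝ (WeakDual ℝ Y) :=
    inferInstanceAs (LocallyConvexSpace ℝ (WeakBilin (topDualPairing ℝ Y)))
  have hsub : B ⊆ {f | f w = 0} := by
    rw [← closure_convexHull_extremePoints hBcomp hBconv]
    refine closure_minimal (convexHull_min (fun f hf => H f hf) ?_)
      (isClosed_eq (WeakDual.eval_continuous _) continuous_const)
    intro f hf g hg a b _ _ _
    change a * f w + b * g w = 0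
    rw [show f w = 0 from hf, show g w = 0 from hg]
    simp
  obtain ⟨g, hg, hgw⟩ := exists_dual_vector ℝ (P w) (norm_ne_zero_iff.2 hw)
  refine hw (norm_eq_zero.1 ?_)
  rw [show ‖P w‖ = g (P w) by simpa using hgw.symm]
  refine hsub (a := StrongDual.toWeakDual (g.comp P)) ⟨?_, ?_⟩
  · refine (g.opNorm_comp_le P).trans ?_
    rw [hg, one_mul]
    exact hP.opNorm_le
  · ext y
    exact congrArg g (hP.idem y)

end L2Projection

/-! ### Centralizers and L-summands in the presence of an L²-projection -/

section Centralizer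

variable {Y : Type*} [NormedAddCommGroup Y] [NormedSpace ℝ Y] {P : Y →L[ℝ] Y}

theorem norm_eq_one_of_mem_extremePoints_invariantDualBall {p : StrongDual ℝ Y}
    (hp : p ∈ (invariantDualBall P).extremePoints ℝ) (h0 : p ≠ 0) : ‖p‖ = 1 := by
  refine le_antisymm hp.1.1 (not_lt.1 fun hlt => h0 ?_)
  have hpos := norm_pos_iff.2 h0
  have hp2 := hp.1.2
  refine (mem_extremePoints_iff_left.1 hp).2 0 ⟨by simp, by simp⟩ (‖p‖⁻¹ • p) ⟨?_, ?_⟩ ?_ |>.symm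
  · rw [norm_smul, norm_inv, norm_norm, inv_mul_cancel₀ hpos.ne']
  · rw [ContinuousLinearMap.smul_comp, hp2]
  · refine ⟨1 - ‖p‖, ‖p‖, by linarith, hpos, by ring, ?_⟩
    rw [smul_zero, zero_add, smul_smul, mul_inv_cancel₀ hpos.ne', one_smul]

theorem eq_smul_of_mem_extremePoints_invariantDualBall {p f g : StrongDual ℝ Y}
    (hp : p ∈ (invariantDualBall P).extremePoints ℝ) {s a b : ℝ} (ha : 0 < a) (hb : 0 < b)
    (hab : a + b = 1) (h : a • f + b • g = s • p) (hf : f.comp P = f) (hg : g.comp P = g)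
    (hfs : ‖f‖ = s) (hgs : ‖g‖ = s) : f = s • p := by
  have hs : 0 ≤ s := hfs ▸ norm_nonneg f
  rcases hs.eq_or_lt with rfl | hs
  · rw [norm_eq_zero.1 hfs, zero_smul]
  · have hmem : ∀ k : StrongDual ℝ Y, k.comp P = k → ‖k‖ = s →
        s⁻¹ • k ∈ invariantDualBall P := by
      intro k hk hks
      refine ⟨?_, by rw [ContinuousLinearMap.smul_comp, hk]⟩
      rw [norm_smul, norm_inv, Real.norm_of_nonneg hs.le, hks, inv_mul_cancel₀ hs.ne']
    have := (mem_extremePoints_iff_left.1 hp).2 _ (hmem f hf hfs) _ (hmem g hg hgs)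
      ⟨a, b, ha, hb, hab, ?_⟩
    · rw [← this, smul_smul, mul_inv_cancel₀ hs.ne', one_smul]
    · rw [smul_comm a, smul_comm b, ← smul_add, h, smul_smul, inv_mul_cancel₀ hs.ne', one_smul]

/-- A point of the unit circle dominated by a convex combination of points of the unit disc
coincides with each of them. -/
theorem eq_and_eq_of_le_convexCombination {a b s t x y z w : ℝ} (ha : 0 < a) (hb : 0 < b)
    (hab : a + b = 1) (hs : 0 ≤ s) (ht : 0 ≤ t) (hst : s ^ 2 + t ^ 2 = 1)
    (hxy : x ^ 2 + y ^ 2 ≤ 1) (hzw : z ^ 2 + w ^ 2 ≤ 1)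
    (h1 : s ≤ a * x + b * z) (h2 : t ≤ a * y + b * w) : x = s ∧ y = t := by
  have h3 : s * x + t * y ≤ 1 := by nlinarith [sq_nonneg (s - x), sq_nonneg (t - y)]
  have h4 : s * z + t * w ≤ 1 := by nlinarith [sq_nonneg (s - z), sq_nonneg (t - w)]
  have h5 : 1 ≤ a * (s * x + t * y) + b * (s * z + t * w) := by
    nlinarith [mul_le_mul_of_nonneg_left h1 hs, mul_le_mul_of_nonneg_left h2 ht]
  have h6 : 1 ≤ s * x + t * y := by
    by_contra! h
    nlinarith [mul_lt_mul_of_pos_left h ha, mul_le_mul_of_nonneg_left h4 hb.le]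
  have h7 : (x - s) ^ 2 + (y - t) ^ 2 ≤ 0 := by nlinarith
  constructor
  · nlinarith [sq_nonneg (x - s), sq_nonneg (y - t)]
  · nlinarith [sq_nonneg (x - s), sq_nonneg (y - t)]

/-- In a convex decomposition, strict convexity of the Euclidean disc forces the two parts of each
term to have norms exactly `s` and `t`. After rescaling, extremality of `p` and `q` determines the
parts. -/
theorem IsL2Projection.smul_add_smul_mem_dualExtremePoints (hP : IsL2Projection P)
    {p q : StrongDual ℝ Y} (hp : p ∈ (invariantDualBall P).extremePoints ℝ)
    (hq : q ∈ (invariantDualBall (ContinuousLinearMap.id ℝ Y - P)).extremePoints ℝ)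
    (hp0 : p ≠ 0) (hq0 : q ≠ 0) {s t : ℝ} (hs : 0 ≤ s) (ht : 0 ≤ t) (hst : s ^ 2 + t ^ 2 = 1) :
    s • p + t • q ∈ dualExtremePoints Y := by
  have hp1 := norm_eq_one_of_mem_extremePoints_invariantDualBall hp hp0
  have hq1 := norm_eq_one_of_mem_extremePoints_invariantDualBall hq hq0
  have hpP : ∀ y, p (P y) = p y := DFunLike.congr_fun hp.1.2
  have hqP : ∀ y, q (P y) = 0 := fun y => by
    have := DFunLike.congr_fun hq.1.2 y
    simpa using this
  have hQ := hP.transpose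
  have hsp : ‖s • p‖ = s := by rw [norm_smul, hp1, mul_one, Real.norm_of_nonneg hs]
  have htq : ‖t • q‖ = t := by rw [norm_smul, hq1, mul_one, Real.norm_of_nonneg ht]
  refine mem_extremePoints_iff_left.2 ⟨?_, ?_⟩
  · rw [mem_closedBall_zero_iff, ← sq_le_sq₀ (norm_nonneg _) zero_le_one,
      hQ.norm_add_sq (by ext y; simp [hpP]) (by ext y; simp [hqP]), hsp, htq, hst, one_pow]
  · rintro f hf g hg ⟨a, b, ha, hb, hab, h⟩
    rw [mem_closedBall_zero_iff] at hf hg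
    have hfn : ‖f‖ ^ 2 = ‖f.comp P‖ ^ 2 + ‖f - f.comp P‖ ^ 2 := hQ.norm_sq f
    have hgn : ‖g‖ ^ 2 = ‖g.comp P‖ ^ 2 + ‖g - g.comp P‖ ^ 2 := hQ.norm_sq g
    have hfn' := hfn.symm.trans_le (pow_le_one₀ (norm_nonneg f) hf)
    have hgn' := hgn.symm.trans_le (pow_le_one₀ (norm_nonneg g) hg)
    have hy : ∀ y, a * f y + b * g y = s * p y + t * q y := DFunLike.congr_fun h
    have e1 : a • f.comp P + b • g.comp P = s • p := by
      ext y
      have := hy (P y)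
      simpa [hpP, hqP] using this
    have e2 : a • (f - f.comp P) + b • (g - g.comp P) = t • q := by
      rw [smul_sub, smul_sub, sub_add_sub_comm, h, e1, add_sub_cancel_left]
    have n1 : s ≤ a * ‖f.comp P‖ + b * ‖g.comp P‖ := by
      rw [← hsp, ← e1]
      refine (norm_add_le _ _).trans_eq ?_
      rw [norm_smul, norm_smul, Real.norm_of_nonneg ha.le, Real.norm_of_nonneg hb.le]
    have n2 : t ≤ a * ‖f - f.comp P‖ + b * ‖g - g.comp P‖ := by
      rw [← htq, ← e2]
      refine (norm_add_le _ _).trans_eq ?_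
      rw [norm_smul, norm_smul, Real.norm_of_nonneg ha.le, Real.norm_of_nonneg hb.le]
    obtain ⟨f1, f2⟩ := eq_and_eq_of_le_convexCombination ha hb hab hs ht hst hfn' hgn' n1 n2
    obtain ⟨g1, g2⟩ := eq_and_eq_of_le_convexCombination hb ha (by linarith) hs ht hst hgn' hfn'
      (by linarith) (by linarith)
    have r1 := eq_smul_of_mem_extremePoints_invariantDualBall hp ha hb hab e1
      (by ext y; simp [hP.idem]) (by ext y; simp [hP.idem]) f1 g1
    have r2 := eq_smul_of_mem_extremePoints_invariantDualBall hq ha hb hab e2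
      (by ext y; simp [hP.idem]) (by ext y; simp [hP.idem]) f2 g2
    rw [← r1, ← r2, add_sub_cancel]

theorem IsL2Projection.exists_common_eigenvalue (hP : IsL2Projection P) {T : Y →L[ℝ] Y}
    (hT : ∀ p ∈ dualExtremePoints Y, ∃ a : ℝ, p.comp T = a • p) {p q : StrongDual ℝ Y}
    (hp : p ∈ (invariantDualBall P).extremePoints ℝ)
    (hq : q ∈ (invariantDualBall (ContinuousLinearMap.id ℝ Y - P)).extremePoints ℝ)
    (hp0 : p ≠ 0) (hq0 : q ≠ 0) : ∃ c : ℝ, p.comp T = c • p ∧ q.comp T = c • q := by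
  have hmem := fun {s t : ℝ} => hP.smul_add_smul_mem_dualExtremePoints hp hq hp0 hq0 (s := s) (t := t)
  obtain ⟨a, ha⟩ := hT p (by simpa using hmem zero_le_one le_rfl (by norm_num))
  obtain ⟨b, hb⟩ := hT q (by simpa using hmem le_rfl zero_le_one (by norm_num))
  -- Any point of the circle with both coordinates positive would do: an eigenvector mixing `p` and
  -- `q` forces their eigenvalues to agree.
  obtain ⟨c, hc⟩ := hT ((3 / 5 : ℝ) • p + (4 / 5 : ℝ) • q)
    (hmem (by norm_num) (by norm_num) (by norm_num))
  rw [ContinuousLinearMap.add_comp, ContinuousLinearMap.smul_comp, ContinuousLinearMap.smul_comp,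
    ha, hb] at hc
  have hpP : ∀ y, p (P y) = p y := DFunLike.congr_fun hp.1.2
  have hqP : ∀ y, q (P y) = 0 := fun y => by
    have := DFunLike.congr_fun hq.1.2 y
    simpa using this
  have hac : a • p = c • p := by
    ext y
    have := DFunLike.congr_fun hc (P y)
    simp only [add_apply, smul_apply, smul_eq_mul, hpP, hqP] at this ⊢
    linarith
  refine ⟨c, ha.trans hac, hb.trans ?_⟩
  ext y
  have h1 := DFunLike.congr_fun hc y
  have h2 := DFunLike.congr_fun hac y
  simp only [add_apply, smul_apply, smul_eq_mul] at h1 h2 ⊢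
  linarith

/-- The space has an `L²`-projection other than `0` and the identity. -/
def HasNontrivialL2Projection (Y : Type*) [NormedAddCommGroup Y] [NormedSpace ℝ Y] : Prop :=
  ∃ P : Y →L[ℝ] Y, IsL2Projection P ∧ (∃ y, P y ≠ 0) ∧ ∃ y, y - P y ≠ 0

theorem HasNontrivialL2Projection.strongDual (h : HasNontrivialL2Projection Y) :
    HasNontrivialL2Projection (StrongDual ℝ Y) := by
  obtain ⟨P, hP, ⟨y, hy⟩, z, hz⟩ := h
  refine ⟨transpose P, hP.transpose, ?_, ?_⟩
  · obtain ⟨f, -, hf⟩ := exists_dual_vector ℝ (P y) (norm_ne_zero_iff.2 hy)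
    refine ⟨f, fun h => hy ?_⟩
    have := DFunLike.congr_fun h y
    rw [← norm_eq_zero]
    exact hf.symm.trans this
  · obtain ⟨f, -, hf⟩ := exists_dual_vector ℝ (z - P z) (norm_ne_zero_iff.2 hz)
    refine ⟨f, fun h => hz ?_⟩
    have := DFunLike.congr_fun h z
    rw [← norm_eq_zero]
    refine hf.symm.trans ?_
    rw [map_sub]
    exact this

/-- Fix one extreme functional on each side. Any other one shares its eigenvalue with the fixed
functional on the opposite side, so a single `a` serves all of them, and together they detect every
nonzero vector. -/
theorem HasNontrivialL2Projection.exists_eq_smul_id (h : HasNontrivialL2Projection Y)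
    {T : Y →L[ℝ] Y} (hT : ∀ p ∈ dualExtremePoints Y, ∃ a : ℝ, p.comp T = a • p) :
    ∃ a : ℝ, T = a • ContinuousLinearMap.id ℝ Y := by
  obtain ⟨P, hP, ⟨y, hy⟩, z, hz⟩ := h
  have hne : ∀ {f : StrongDual ℝ Y} {w : Y}, f w ≠ 0 → f ≠ 0 := by
    rintro f w hf rfl
    exact hf rfl
  obtain ⟨p, hp, hpy⟩ := exists_extremePoint_invariantDualBall_apply_ne_zero hP hy
  obtain ⟨q, hq, hqz⟩ := exists_extremePoint_invariantDualBall_apply_ne_zero hP.compl hz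
  obtain ⟨a, hap, haq⟩ := hP.exists_common_eigenvalue hT hp hq (hne hpy) (hne hqz)
  refine ⟨a, ContinuousLinearMap.ext fun x => sub_eq_zero.1 ?_⟩
  change T x - a • x = 0
  have hkey : ∀ f : StrongDual ℝ Y, f.comp T = a • f → f (T x - a • x) = 0 := fun f hf => by
    have := DFunLike.congr_fun hf x
    rw [map_sub, map_smul, sub_eq_zero]
    exact this
  have hcancel : ∀ {f : StrongDual ℝ Y} {c : ℝ}, f ≠ 0 → f.comp T = a • f → f.comp T = c • f →
      c = a := fun hf h1 h2 => smul_left_injective ℝ hf (h2.symm.trans h1)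
  have h1 : P (T x - a • x) = 0 := by
    by_contra hw
    obtain ⟨f, hf, hfw⟩ := exists_extremePoint_invariantDualBall_apply_ne_zero hP hw
    obtain ⟨c, hc, hcq⟩ := hP.exists_common_eigenvalue hT hf hq (hne hfw) (hne hqz)
    rw [hcancel (hne hqz) haq hcq] at hc
    exact hfw (hkey f hc)
  have h2 : (ContinuousLinearMap.id ℝ Y - P) (T x - a • x) = 0 := by
    by_contra hw
    obtain ⟨f, hf, hfw⟩ := exists_extremePoint_invariantDualBall_apply_ne_zero hP.compl hw
    obtain ⟨c, hcp, hc⟩ := hP.exists_common_eigenvalue hT hp hf (hne hpy) (hne hfw)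
    rw [hcancel (hne hpy) hap hcp] at hc
    exact hfw (hkey f hc)
  rwa [sub_apply, h1, sub_zero] at h2

theorem HasNontrivialL2Projection.rank_centralizer (h : HasNontrivialL2Projection Y) :
    Module.rank ℝ (centralizer Y) = 1 := by
  have hid : ContinuousLinearMap.id ℝ Y ∈ centralizer Y :=
    ⟨ContinuousLinearMap.id ℝ Y, fun p _ => ⟨1, by simp, by simp⟩⟩
  refine rank_eq_one (⟨_, hid⟩ : centralizer Y) ?_ ?_
  · obtain ⟨P, -, ⟨y, hy⟩, -⟩ := h
    intro h0
    have h1 : ContinuousLinearMap.id ℝ Y = 0 := congrArg Subtype.val h0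
    exact hy (DFunLike.congr_fun h1 (P y))
  · rintro ⟨T, S, hT⟩
    obtain ⟨a, rfl⟩ := h.exists_eq_smul_id fun p hp => (hT p hp).imp fun a ha => ha.1
    exact ⟨a, rfl⟩

theorem HasNontrivialL2Projection.evenDual {X : Type*} [NormedAddCommGroup X] [NormedSpace ℝ X]
    (h : HasNontrivialL2Projection X) :
    ∀ n, HasNontrivialL2Projection (evenDual X n).carrier
  | 0 => h
  | n + 1 => (h.evenDual n).strongDual.strongDual

/-- A proper subspace invariant under an `L²`-projection, on which neither the projection nor its
complement vanishes, is not an `L`-summand. -/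
theorem not_isLSummand_of_isL2Projection (hP : IsL2Projection P) {M : Submodule ℝ Y}
    (hM : ∀ x ∈ M, P x ∈ M) (h1 : ∃ x ∈ M, P x ≠ 0) (h2 : ∃ x ∈ M, x - P x ≠ 0) (hne : M ≠ ⊤) :
    ¬ IsLSummand Y M := by
  rintro ⟨N, hMN, hN⟩
  have key : ∀ {Q : Y →L[ℝ] Y}, IsL2Projection Q → (∃ x ∈ M, Q x = x ∧ x ≠ 0) →
      ∀ z ∈ N, z - Q z = 0 := by
    rintro Q hQ ⟨x, hx, hQx, hx0⟩ z hz
    have e := hN x hx z hz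
    have a1 := hQ.norm_sq (x + z)
    have a2 := hQ.norm_sq z
    rw [e, map_add, hQx, add_sub_add_left_eq_sub] at a1
    have a3 := norm_add_le x (Q z)
    have a4 : ‖Q z‖ ≤ ‖z‖ := hQ.norm_apply_le z
    have hx' := norm_pos_iff.2 hx0
    -- Combining the identities gives `(‖x‖ + ‖z‖)² ≤ (‖x‖ + ‖Q z‖)² + ‖z‖² - ‖Q z‖²`, that is, `‖x‖
    -- ‖z‖ ≤ ‖x‖ ‖Q z‖`.
    have a5 : ‖z‖ ≤ ‖Q z‖ := by
      have : ‖x + Q z‖ ^ 2 ≤ (‖x‖ + ‖Q z‖) ^ 2 := by gcongr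
      nlinarith
    have a6 : ‖z - Q z‖ ^ 2 ≤ 0 := by nlinarith [norm_nonneg (Q z), norm_nonneg z]
    exact norm_eq_zero.1 (pow_eq_zero_iff two_ne_zero |>.1 (le_antisymm a6 (sq_nonneg _)))
  have hN0 : N = ⊥ := by
    rw [eq_bot_iff]
    intro z hz
    obtain ⟨x, hx, hx0⟩ := h1
    obtain ⟨x', hx', hx0'⟩ := h2
    have b1 := key hP ⟨P x, hM x hx, hP.idem x, hx0⟩ z hz
    have b2 := key hP.compl ⟨x' - P x', M.sub_mem hx' (hM x' hx'), hP.compl.idem x', hx0'⟩ z hz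
    rw [sub_apply, ContinuousLinearMap.id_apply, sub_sub_cancel] at b2
    rwa [b2, sub_zero] at b1
  refine hne ?_
  rw [← sup_bot_eq M, ← hN0]
  exact hMN.sup_eq_top

end Centralizer

open Filter Topology

/-! ### A criterion for strict u-ideals -/

section StrictUIdeal

variable {X : Type*} [NormedAddCommGroup X] [NormedSpace ℝ X]

theorem mem_annihilator_canonicalImage {F : StrongDual ℝ (StrongDual ℝ (StrongDual ℝ X))} :
    F ∈ annihilator (StrongDual ℝ (StrongDual ℝ X)) (canonicalImage X) ↔
      ∀ x : X, F (NormedSpace.inclusionInDoubleDual ℝ X x) = 0 := by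
  rw [annihilator, StrongDual.mem_polarSubmodule]
  constructor
  · exact fun h x => h _ ⟨x, rfl⟩
  · rintro h _ ⟨x, rfl⟩
    exact h x

/-- `X*** = X^⊥ ⊕ X*`. -/
theorem isCompl_annihilator_canonicalImage :
    IsCompl (annihilator (StrongDual ℝ (StrongDual ℝ X)) (canonicalImage X))
      (canonicalImage (StrongDual ℝ X)) := by
  constructor
  · rw [Submodule.disjoint_def]
    rintro _ h ⟨f, rfl⟩
    have : f = 0 := ContinuousLinearMap.ext fun x => mem_annihilator_canonicalImage.1 h x
    rw [this]
    exact map_zero _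
  · rw [codisjoint_iff, Submodule.eq_top_iff']
    intro F
    set f : StrongDual ℝ X := F.comp (NormedSpace.inclusionInDoubleDual ℝ X) with hf
    rw [Submodule.mem_sup]
    refine ⟨F - NormedSpace.inclusionInDoubleDual ℝ _ f, ?_,
      NormedSpace.inclusionInDoubleDual ℝ _ f, ⟨f, rfl⟩, sub_add_cancel _ _⟩
    rw [mem_annihilator_canonicalImage]
    intro x
    rw [sub_apply, NormedSpace.dual_def, NormedSpace.dual_def]
    exact sub_self _

/-- The bidual of `T` maps `X**` into `X`. -/
def BidualMapsIntoCanonicalImage (T : X →L[ℝ] X) : Prop :=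
  ∀ φ, transpose (transpose T) φ ∈ canonicalImage X

theorem BidualMapsIntoCanonicalImage.add {S T : X →L[ℝ] X} (hS : BidualMapsIntoCanonicalImage S)
    (hT : BidualMapsIntoCanonicalImage T) : BidualMapsIntoCanonicalImage (S + T) := fun φ => by
  convert (canonicalImage X).add_mem (hS φ) (hT φ) using 1
  ext f
  change φ (f.comp (S + T)) = φ (f.comp S) + φ (f.comp T)
  rw [ContinuousLinearMap.comp_add, map_add]

theorem BidualMapsIntoCanonicalImage.sum {ι : Type*} (s : Finset ι) {T : ι → X →L[ℝ] X}
    (h : ∀ i ∈ s, BidualMapsIntoCanonicalImage (T i)) :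
    BidualMapsIntoCanonicalImage (∑ i ∈ s, T i) :=
  Finset.sum_induction _ _ (fun _ _ => BidualMapsIntoCanonicalImage.add)
    (fun φ => by
      convert (canonicalImage X).zero_mem using 1
      ext f
      change φ (f.comp 0) = 0
      rw [ContinuousLinearMap.comp_zero, map_zero]) h

theorem bidualMapsIntoCanonicalImage_smulRight (g : StrongDual ℝ X) (x : X) :
    BidualMapsIntoCanonicalImage (g.smulRight x) := fun φ => by
  refine ⟨φ g • x, ?_⟩
  ext f
  change f (φ g • x) = φ (f.comp (g.smulRight x))
  rw [show f.comp (g.smulRight x) = f x • g by ext y; simp [mul_comm], map_smul, map_smul]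
  exact mul_comm _ _

/-- Since `F` vanishes on `X` and the bidual of `T n` takes values in `X`, the third transpose of
the contraction `I - 2 T n` affects only the `X*` part of `F + f`, and in the limit reverses its
sign. -/
theorem isStrictUIdealInBidual_of_tendsto (T : ℕ → X →L[ℝ] X)
    (h1 : ∀ n, ‖ContinuousLinearMap.id ℝ X - (2 : ℝ) • T n‖ ≤ 1)
    (h2 : ∀ n, BidualMapsIntoCanonicalImage (T n))
    (h3 : ∀ f : StrongDual ℝ X, Tendsto (fun n => f.comp (T n)) atTop (𝓝 f)) :
    IsStrictUIdealInBidual X := by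
  set ι := NormedSpace.inclusionInDoubleDual ℝ (StrongDual ℝ X)
  have key : ∀ F ∈ annihilator (StrongDual ℝ (StrongDual ℝ X)) (canonicalImage X),
      ∀ f, ‖F - ι f‖ ≤ ‖F + ι f‖ := by
    intro F hF f
    have hF' := StrongDual.mem_polarSubmodule (𝕜 := ℝ) (canonicalImage X) F |>.1 hF
    have e : ∀ n, transpose (transpose (transpose (ContinuousLinearMap.id ℝ X - (2 : ℝ) • T n)))
        (F + ι f) = F + ι f - (2 : ℝ) • ι (f.comp (T n)) := by
      intro n
      ext φ
      have e1 : transpose (transpose (ContinuousLinearMap.id ℝ X - (2 : ℝ) • T n)) φ =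
          φ - (2 : ℝ) • transpose (transpose (T n)) φ := by
        ext g
        change φ (g.comp _) = φ g - (2 : ℝ) • φ (g.comp (T n))
        rw [ContinuousLinearMap.comp_sub, ContinuousLinearMap.comp_smul, map_sub, map_smul,
          ContinuousLinearMap.comp_id]
      change (F + ι f) (transpose (transpose (ContinuousLinearMap.id ℝ X - (2 : ℝ) • T n)) φ) =
        (F + ι f) φ - (2 : ℝ) • φ (f.comp (T n))
      rw [e1, map_sub, map_smul, add_apply _ _ (transpose (transpose (T n)) φ), hF' _ (h2 n φ),
        zero_add]
      rfl
    have hle : ∀ n, ‖F + ι f - (2 : ℝ) • ι (f.comp (T n))‖ ≤ ‖F + ι f‖ := by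
      intro n
      rw [← e]
      refine (ContinuousLinearMap.le_opNorm _ _).trans (mul_le_of_le_one_left (norm_nonneg _) ?_)
      exact ((norm_transpose_le _).trans ((norm_transpose_le _).trans (norm_transpose_le _))).trans
        (h1 n)
    have hlim : Tendsto (fun n => F + ι f - (2 : ℝ) • ι (f.comp (T n))) atTop
        (𝓝 (F + ι f - (2 : ℝ) • ι f)) :=
      tendsto_const_nhds.sub (((ι.continuous.tendsto f).comp (h3 f)).const_smul 2)
    rw [show F - ι f = F + ι f - (2 : ℝ) • ι f by rw [two_smul]; abel]
    exact le_of_tendsto' hlim.norm hle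
  have hU : IsUComplement (StrongDual ℝ (StrongDual ℝ (StrongDual ℝ X)))
      (annihilator (StrongDual ℝ (StrongDual ℝ X)) (canonicalImage X))
      (canonicalImage (StrongDual ℝ X)) := by
    refine ⟨isCompl_annihilator_canonicalImage, ?_⟩
    rintro F hF _ ⟨f, rfl⟩
    -- The reverse inequality is `key` at `-f`.
    refine le_antisymm ?_ (key F hF f)
    have := key F hF (-f)
    rwa [map_neg, sub_neg_eq_add, ← sub_eq_add_neg] at this
  exact ⟨⟨_, hU⟩, hU⟩

end StrictUIdeal

/-! ### The space c₀ and its dual -/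

namespace CZero

theorem norm_le {x : C₀(ℕ, ℝ)} {C : ℝ} (hC : 0 ≤ C) : ‖x‖ ≤ C ↔ ∀ n, ‖x n‖ ≤ C := by
  rw [← ZeroAtInftyContinuousMap.norm_toBCF_eq_norm, BoundedContinuousFunction.norm_le hC]
  rfl

theorem norm_apply_le (x : C₀(ℕ, ℝ)) (n : ℕ) : ‖x n‖ ≤ ‖x‖ :=
  (norm_le (norm_nonneg x)).1 le_rfl n

theorem tendsto_zero (x : C₀(ℕ, ℝ)) : Tendsto x atTop (𝓝 0) := by
  have := x.zero_at_infty'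
  rwa [cocompact_eq_cofinite, Nat.cofinite_eq_atTop] at this

/-- The `n`-th unit vector of `c₀`. -/
def unitVector (n : ℕ) : C₀(ℕ, ℝ) where
  toFun := Pi.single n 1
  continuous_toFun := continuous_of_discreteTopology
  zero_at_infty' := by
    rw [cocompact_eq_cofinite, Nat.cofinite_eq_atTop]
    refine tendsto_const_nhds.congr' ?_
    filter_upwards [eventually_gt_atTop n] with m hm
    exact (Pi.single_eq_of_ne (M := fun _ => ℝ) hm.ne' 1).symm

theorem unitVector_apply (n m : ℕ) : unitVector n m = if m = n then 1 else 0 :=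
  Pi.single_apply n (1 : ℝ) m

theorem unitVector_self (n : ℕ) : unitVector n n = 1 := by simp [unitVector_apply]

/-- The `n`-th coordinate functional on `c₀`. -/
def coord (n : ℕ) : StrongDual ℝ C₀(ℕ, ℝ) :=
  LinearMap.mkContinuous ⟨⟨fun x => x n, fun _ _ => rfl⟩, fun _ _ => rfl⟩ 1
    fun x => by rw [one_mul]; exact norm_apply_le x n

theorem coord_apply (n : ℕ) (x : C₀(ℕ, ℝ)) : coord n x = x n := rfl

theorem norm_coord_le (n : ℕ) : ‖coord n‖ ≤ 1 := LinearMap.mkContinuous_norm_le _ zero_le_one _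

/-- The projection onto the span of the first `n` unit vectors. -/
def truncation (n : ℕ) : C₀(ℕ, ℝ) →L[ℝ] C₀(ℕ, ℝ) :=
  ∑ i ∈ Finset.range n, (coord i).smulRight (unitVector i)

theorem sum_smul_unitVector_apply (s : Finset ℕ) (a : ℕ → ℝ) (m : ℕ) :
    (∑ i ∈ s, a i • unitVector i) m = if m ∈ s then a m else 0 := by
  rw [← coord_apply, map_sum]
  simp [coord_apply, unitVector_apply]

theorem truncation_apply (n : ℕ) (x : C₀(ℕ, ℝ)) (m : ℕ) :
    truncation n x m = if m < n then x m else 0 := by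
  rw [truncation, sum_apply]
  simp only [ContinuousLinearMap.smulRight_apply]
  rw [sum_smul_unitVector_apply]
  simp [coord_apply]

theorem tendsto_truncation (x : C₀(ℕ, ℝ)) : Tendsto (fun n => truncation n x) atTop (𝓝 x) := by
  rw [Metric.tendsto_atTop]
  intro ε hε
  obtain ⟨N, hN⟩ := Metric.tendsto_atTop.1 (tendsto_zero x) (ε / 2) (half_pos hε)
  refine ⟨N, fun n hn => ?_⟩
  rw [dist_eq_norm]
  refine ((norm_le (half_pos hε).le).2 fun m => ?_).trans_lt (half_lt_self hε)
  rw [ZeroAtInftyContinuousMap.sub_apply, truncation_apply]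
  split_ifs with h
  · simpa using (half_pos hε).le
  · have := hN m (by omega)
    rw [dist_zero_right] at this
    rw [zero_sub, norm_neg]
    exact this.le

/-- Half of the duality between `c₀` and `ℓ¹`: test `f` on the finite sign vector of its
coefficients, which lies in the unit ball. -/
theorem sum_norm_apply_unitVector_le (f : StrongDual ℝ C₀(ℕ, ℝ)) (s : Finset ℕ) :
    ∑ i ∈ s, ‖f (unitVector i)‖ ≤ ‖f‖ := by
  set x : C₀(ℕ, ℝ) := ∑ i ∈ s, (SignType.sign (f (unitVector i)) : ℝ) • unitVector i
  have hx : ‖x‖ ≤ 1 := by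
    refine (norm_le zero_le_one).2 fun m => ?_
    rw [sum_smul_unitVector_apply]
    split_ifs
    · rcases SignType.sign (f (unitVector m)) with _ | _ | _ <;> simp
    · simp
  have hfx : f x = ∑ i ∈ s, ‖f (unitVector i)‖ := by
    rw [map_sum]
    refine Finset.sum_congr rfl fun i _ => ?_
    rw [map_smul, smul_eq_mul, sign_mul_self, Real.norm_eq_abs]
  rw [← hfx]
  exact (le_abs_self _).trans (f.unit_le_opNorm x hx)

theorem summable_norm_apply_unitVector (f : StrongDual ℝ C₀(ℕ, ℝ)) :
    Summable fun n => ‖f (unitVector n)‖ :=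
  summable_of_sum_le (fun _ => norm_nonneg _) (sum_norm_apply_unitVector_le f)

theorem tendsto_apply_unitVector (f : StrongDual ℝ C₀(ℕ, ℝ)) :
    Tendsto (fun n => f (unitVector n)) atTop (𝓝 0) :=
  tendsto_zero_iff_norm_tendsto_zero.2 (summable_norm_apply_unitVector f).tendsto_atTop_zero

/-- The compositions are partial sums of a norm convergent series; its limit is `f` because
truncations converge pointwise. -/
theorem tendsto_comp_truncation (f : StrongDual ℝ C₀(ℕ, ℝ)) :
    Tendsto (fun n => f.comp (truncation n)) atTop (𝓝 f) := by
  have hs : Summable fun n => f (unitVector n) • coord n := by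
    refine Summable.of_norm_bounded (summable_norm_apply_unitVector f) fun n => ?_
    rw [norm_smul]
    exact mul_le_of_le_one_right (norm_nonneg _) (norm_coord_le n)
  obtain ⟨g, hg⟩ := hs
  have e : (fun n => f.comp (truncation n)) =
      fun n => ∑ i ∈ Finset.range n, f (unitVector i) • coord i := by
    ext n x
    simp [truncation, mul_comm]
  have ht := hg.tendsto_sum_nat
  rw [← e] at ht
  have : g = f := by
    ext x
    refine tendsto_nhds_unique (((ContinuousLinearMap.apply ℝ ℝ x).continuous.tendsto g).comp ht) ?_
    exact (f.continuous.tendsto x).comp (tendsto_truncation x)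
  rwa [this] at ht

/-- The element of `c₀** = ℓ^∞` whose coordinates are all `1`. -/
def sumCoordinates : StrongDual ℝ (StrongDual ℝ C₀(ℕ, ℝ)) :=
  LinearMap.mkContinuous
    { toFun := fun f => ∑' n, f (unitVector n)
      map_add' := fun f g => (summable_norm_apply_unitVector f).of_norm.tsum_add
        (summable_norm_apply_unitVector g).of_norm
      map_smul' := fun c f => tsum_mul_left } 1 fun f => by
    rw [one_mul]
    exact (norm_tsum_le_tsum_norm (summable_norm_apply_unitVector f)).trans
      ((summable_norm_apply_unitVector f).tsum_le_of_sum_le (sum_norm_apply_unitVector_le f))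

theorem sumCoordinates_coord (n : ℕ) : sumCoordinates (coord n) = 1 := by
  change ∑' m, coord n (unitVector m) = 1
  rw [tsum_eq_single n fun m hm => ?_]
  · exact unitVector_self n
  · rw [coord_apply, unitVector_apply, if_neg hm.symm]

theorem norm_smul_unitVector (c : ℝ) (n : ℕ) : ‖c • unitVector n‖ = |c| := by
  apply le_antisymm
  · refine (norm_le (abs_nonneg c)).2 fun m => ?_
    rw [ZeroAtInftyContinuousMap.smul_apply, unitVector_apply]
    split_ifs <;> simp
  · have := norm_apply_le (c • unitVector n) n
    rwa [ZeroAtInftyContinuousMap.smul_apply, unitVector_self, smul_eq_mul, mul_one] at this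

/-- The vector is `x` with its `n`-th coordinate overwritten by `c`, which the sup norm tolerates.
-/
theorem norm_replace_le (x : C₀(ℕ, ℝ)) (n : ℕ) {c t : ℝ} (hx : ‖x‖ ≤ t) (hc : |c| ≤ t) :
    ‖x + (c - x n) • unitVector n‖ ≤ t := by
  refine (norm_le ((abs_nonneg c).trans hc)).2 fun m => ?_
  rw [ZeroAtInftyContinuousMap.add_apply, ZeroAtInftyContinuousMap.smul_apply, unitVector_apply]
  split_ifs with h
  · subst h
    simpa using hc
  · simpa using (norm_apply_le x m).trans hx

/-- Overwriting coordinate `n` by `c` costs nothing; restoring the old entry costs at most `|x n|`.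
-/
theorem norm_add_smul_unitVector_le (x : C₀(ℕ, ℝ)) (n : ℕ) {c : ℝ} (hc : |c| ≤ ‖x‖) :
    ‖x + c • unitVector n‖ ≤ ‖x‖ + |x n| := by
  have h := norm_add_le (x + (c - x n) • unitVector n) (x n • unitVector n)
  rw [norm_smul_unitVector, add_assoc, ← add_smul, sub_add_cancel] at h
  exact h.trans (by gcongr; exact norm_replace_le x n le_rfl hc)

theorem norm_sub_two_smul_truncation_le (x : C₀(ℕ, ℝ)) (n : ℕ) :
    ‖x - (2 : ℝ) • truncation n x‖ ≤ ‖x‖ := by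
  refine (norm_le (norm_nonneg x)).2 fun m => ?_
  rw [ZeroAtInftyContinuousMap.sub_apply, ZeroAtInftyContinuousMap.smul_apply, truncation_apply]
  refine le_of_eq_of_le ?_ (norm_apply_le x m)
  split_ifs
  · rw [smul_eq_mul, two_mul, sub_add_cancel_left, norm_neg]
  · simp

end CZero

/-! ### The six properties of c₀ ⊕₂ c₀ -/

namespace CZeroSumTwo

open CZero

/-- The embedding of `c₀` as the first summand. -/
def inl : C₀(ℕ, ℝ) →L[ℝ] CZeroSumTwo :=
  ((WithLp.prodContinuousLinearEquiv 2 ℝ C₀(ℕ, ℝ) C₀(ℕ, ℝ)).symm :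
    C₀(ℕ, ℝ) × C₀(ℕ, ℝ) →L[ℝ] CZeroSumTwo).comp (ContinuousLinearMap.inl ℝ _ _)

/-- The embedding of `c₀` as the second summand. -/
def inr : C₀(ℕ, ℝ) →L[ℝ] CZeroSumTwo :=
  ((WithLp.prodContinuousLinearEquiv 2 ℝ C₀(ℕ, ℝ) C₀(ℕ, ℝ)).symm :
    C₀(ℕ, ℝ) × C₀(ℕ, ℝ) →L[ℝ] CZeroSumTwo).comp (ContinuousLinearMap.inr ℝ _ _)

/-- The first coordinate. -/
def fst : CZeroSumTwo →L[ℝ] C₀(ℕ, ℝ) := WithLp.fstL 2 ℝ _ _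

/-- The second coordinate. -/
def snd : CZeroSumTwo →L[ℝ] C₀(ℕ, ℝ) := WithLp.sndL 2 ℝ _ _

@[simp] theorem fst_inl (x : C₀(ℕ, ℝ)) : fst (inl x) = x := rfl
@[simp] theorem fst_inr (x : C₀(ℕ, ℝ)) : fst (inr x) = 0 := rfl
@[simp] theorem snd_inl (x : C₀(ℕ, ℝ)) : snd (inl x) = 0 := rfl
@[simp] theorem snd_inr (x : C₀(ℕ, ℝ)) : snd (inr x) = x := rfl

theorem norm_sq (x : CZeroSumTwo) : ‖x‖ ^ 2 = ‖fst x‖ ^ 2 + ‖snd x‖ ^ 2 :=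
  WithLp.prod_norm_sq_eq_of_L2 x

theorem inl_fst_add_inr_snd (x : CZeroSumTwo) : inl (fst x) + inr (snd x) = x := by
  apply WithLp.ofLp_injective
  exact Prod.ext (add_zero _) (zero_add _)

theorem norm_le_of_fst_snd {x y : CZeroSumTwo} (h1 : ‖fst x‖ ≤ ‖fst y‖) (h2 : ‖snd x‖ ≤ ‖snd y‖) :
    ‖x‖ ≤ ‖y‖ := by
  rw [← sq_le_sq₀ (norm_nonneg _) (norm_nonneg _), norm_sq, norm_sq]
  gcongr

theorem isL2Projection : IsL2Projection (inl.comp fst) where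
  idem _ := rfl
  norm_sq x := by
    rw [norm_sq x, norm_sq, norm_sq (x - _)]
    simp

theorem hasNontrivialL2Projection : HasNontrivialL2Projection CZeroSumTwo := by
  have h : ∀ {x : C₀(ℕ, ℝ)}, x = unitVector 0 → x ≠ 0 := by
    rintro _ rfl h
    simpa [unitVector_self] using DFunLike.congr_fun h 0
  refine ⟨_, isL2Projection, ⟨inl (unitVector 0), fun h0 => h rfl (congrArg fst h0)⟩,
    inr (unitVector 0), fun h0 => h ?_ (congrArg snd h0)⟩
  simp

theorem isStrictUIdealInBidual : IsStrictUIdealInBidual CZeroSumTwo := by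
  refine isStrictUIdealInBidual_of_tendsto
    (fun n => inl.comp ((truncation n).comp fst) + inr.comp ((truncation n).comp snd)) ?_ ?_ ?_
  · refine fun n => ContinuousLinearMap.opNorm_le_bound _ zero_le_one fun x => ?_
    rw [one_mul]
    apply norm_le_of_fst_snd
    · simpa using norm_sub_two_smul_truncation_le (fst x) n
    · simpa using norm_sub_two_smul_truncation_le (snd x) n
  · intro n
    have e : inl.comp ((truncation n).comp fst) + inr.comp ((truncation n).comp snd) =
        ∑ i ∈ Finset.range n, (((coord i).comp fst).smulRight (inl (unitVector i)) +
          ((coord i).comp snd).smulRight (inr (unitVector i))) := by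
      ext1 x
      simp [truncation, Finset.sum_add_distrib]
    rw [e]
    exact .sum _ fun i _ => (bidualMapsIntoCanonicalImage_smulRight _ _).add
      (bidualMapsIntoCanonicalImage_smulRight _ _)
  · intro f
    have e : f = (f.comp inl).comp fst + (f.comp inr).comp snd := by
      ext x
      change f x = f (inl (fst x)) + f (inr (snd x))
      rw [← map_add, inl_fst_add_inr_snd]
    have h1 := ((transpose fst).continuous.tendsto _).comp (tendsto_comp_truncation (f.comp inl))
    have h2 := ((transpose snd).continuous.tendsto _).comp (tendsto_comp_truncation (f.comp inr))
    have h := h1.add h2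
    rw [show transpose fst (f.comp inl) + transpose snd (f.comp inr) = f from e.symm] at h
    refine h.congr fun n => ?_
    ext x
    change f (inl (truncation n (fst x))) + f (inr (truncation n (snd x))) =
      f (inl (truncation n (fst x)) + inr (truncation n (snd x)))
    rw [map_add]

/-- Moving a bounded amount in the direction of the `n`-th unit vectors is weakly negligible. -/
theorem tendsto_toWeakSpace_add {c d : ℕ → ℝ} {c' d' : ℝ} (hc : Tendsto c atTop (𝓝 c'))
    (hd : Tendsto d atTop (𝓝 d')) (x : CZeroSumTwo) :
    Tendsto (fun n => toWeakSpace ℝ CZeroSumTwo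
      (x + (inl (c n • unitVector n) + inr (d n • unitVector n)))) atTop
      (𝓝 (toWeakSpace ℝ CZeroSumTwo x)) := by
  refine (WeakBilin.tendsto_iff_forall_eval_tendsto (topDualPairing ℝ CZeroSumTwo).flip
    fun y z h => ?_).2 fun f => ?_
  · exact SeparatingDual.eq_iff_forall_dual_eq (R := ℝ) |>.2 fun g => DFunLike.congr_fun h g
  · change Tendsto (fun n => f (x + (inl (c n • unitVector n) + inr (d n • unitVector n)))) atTop
      (𝓝 (f x))
    have h := (tendsto_const_nhds (x := f x)).add
      ((hc.mul (tendsto_apply_unitVector (f.comp inl))).add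
        (hd.mul (tendsto_apply_unitVector (f.comp inr))))
    simp only [mul_zero, add_zero] at h
    refine h.congr fun n => ?_
    simp

theorem hasDiameterTwoProperty : HasDiameterTwoProperty CZeroSumTwo := by
  rintro U hU ⟨x, hxU, hx⟩
  set S := toWeakSpace ℝ CZeroSumTwo ⁻¹' U ∩ Metric.closedBall (0 : CZeroSumTwo) 1
  have hSb : Bornology.IsBounded S := Metric.isBounded_closedBall.subset Set.inter_subset_right
  rw [mem_closedBall_zero_iff] at hx
  have hx2 : ‖fst x‖ ^ 2 + ‖snd x‖ ^ 2 ≤ 1 := by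
    rw [← norm_sq]
    exact pow_le_one₀ (norm_nonneg x) hx
  -- Enlarging the first norm to `t` puts `(t, ‖snd x‖)` on the unit circle. Overwriting the `n`-th
  -- coordinates by plus or minus this pair gives two points of the ball whose difference has norm
  -- 2.
  have ht := Real.sq_sqrt (show 0 ≤ 1 - ‖snd x‖ ^ 2 by nlinarith [sq_nonneg ‖fst x‖])
  have ht0 := Real.sqrt_nonneg (1 - ‖snd x‖ ^ 2)
  have hxt : ‖fst x‖ ≤ √(1 - ‖snd x‖ ^ 2) := Real.le_sqrt_of_sq_le (by linarith)
  set t := √(1 - ‖snd x‖ ^ 2)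
  let p : ℝ → ℕ → CZeroSumTwo := fun σ n => x +
    (inl ((σ * t - fst x n) • unitVector n) + inr ((σ * ‖snd x‖ - snd x n) • unitVector n))
  have hfst : ∀ σ n, fst (p σ n) = fst x + (σ * t - fst x n) • unitVector n := fun σ n => by
    simp [p, -map_smul]
  have hsnd : ∀ σ n, snd (p σ n) = snd x + (σ * ‖snd x‖ - snd x n) • unitVector n := fun σ n => by
    simp [p, -map_smul]
  have hball : ∀ σ n, |σ| = 1 → p σ n ∈ Metric.closedBall (0 : CZeroSumTwo) 1 := by
    intro σ n hσ
    rw [mem_closedBall_zero_iff, ← sq_le_sq₀ (norm_nonneg _) zero_le_one, norm_sq, hfst, hsnd]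
    have h1 := norm_replace_le (fst x) n (c := σ * t) hxt
      (by rw [abs_mul, hσ, one_mul, abs_of_nonneg ht0])
    have h2 := norm_replace_le (snd x) n (c := σ * ‖snd x‖) le_rfl
      (by rw [abs_mul, hσ, one_mul, abs_norm])
    have h1' := pow_le_pow_left₀ (norm_nonneg _) h1 2
    have h2' := pow_le_pow_left₀ (norm_nonneg _) h2 2
    linarith
  have hweak : ∀ σ, ∀ᶠ n in atTop, toWeakSpace ℝ CZeroSumTwo (p σ n) ∈ U := fun σ =>
    (tendsto_toWeakSpace_add (tendsto_const_nhds.sub (tendsto_zero (fst x)))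
      (tendsto_const_nhds.sub (tendsto_zero (snd x))) x).eventually (hU.mem_nhds hxU)
  obtain ⟨n, hn1, hn2⟩ := ((hweak 1).and (hweak (-1))).exists
  apply le_antisymm
  · refine (Metric.diam_mono Set.inter_subset_right Metric.isBounded_closedBall).trans ?_
    simpa using Metric.diam_closedBall (x := (0 : CZeroSumTwo)) zero_le_one
  · refine le_of_eq_of_le ?_ (Metric.dist_le_diam_of_mem hSb
      (show p 1 n ∈ S from ⟨hn1, hball 1 n (by simp)⟩)
      (show p (-1) n ∈ S from ⟨hn2, hball (-1) n (by simp)⟩))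
    rw [dist_eq_norm, ← sq_eq_sq₀ zero_le_two (norm_nonneg _), norm_sq, map_sub, map_sub, hfst,
      hfst, hsnd, hsnd, add_sub_add_left_eq_sub, add_sub_add_left_eq_sub, ← sub_smul, ← sub_smul,
      norm_smul_unitVector, norm_smul_unitVector, sq_abs, sq_abs]
    linear_combination (-4) * ht

theorem exists_notMem_canonicalImage :
    ∃ φ : StrongDual ℝ (StrongDual ℝ CZeroSumTwo), φ ∉ canonicalImage CZeroSumTwo := by
  refine ⟨transpose (transpose inl) sumCoordinates, ?_⟩
  rintro ⟨x, hx⟩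
  have h : ∀ n, fst x n = 1 := fun n => by
    have h1 := DFunLike.congr_fun hx ((coord n).comp fst)
    exact h1.trans (sumCoordinates_coord n)
  have h2 := tendsto_zero (fst x)
  rw [show (fst x : ℕ → ℝ) = fun _ => 1 from funext h] at h2
  exact one_ne_zero (tendsto_nhds_unique tendsto_const_nhds h2)

/-- Completeness makes `X` closed in `X**`, so a nonzero functional annihilates `X`; it cannot lie
in `X*`, since `X^⊥ ∩ X* = 0`. -/
theorem canonicalImage_strongDual_ne_top {X : Type*} [NormedAddCommGroup X] [NormedSpace ℝ X]
    [CompleteSpace X] {φ : StrongDual ℝ (StrongDual ℝ X)} (hφ : φ ∉ canonicalImage X) :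
    canonicalImage (StrongDual ℝ X) ≠ ⊤ := by
  intro htop
  have hclosed : IsClosed (canonicalImage X : Set (StrongDual ℝ (StrongDual ℝ X))) :=
    (NormedSpace.inclusionInDoubleDualLi (𝕜 := ℝ) (E := X)).isometry.isClosedEmbedding.isClosed_range
  obtain ⟨F, u, hF, hu⟩ := geometric_hahn_banach_closed_point (canonicalImage X).convex hclosed hφ
  have hu0 : 0 < u := by simpa using hF 0 (canonicalImage X).zero_mem
  have hFann : F ∈ annihilator (StrongDual ℝ (StrongDual ℝ X)) (canonicalImage X) := by
    rw [annihilator, StrongDual.mem_polarSubmodule]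
    intro y hy
    by_contra h
    -- The multiple is chosen so that `F` takes the value `u`, contradicting the strict bound.
    have := hF _ ((canonicalImage X).smul_mem (u / F y) hy)
    rw [map_smul, smul_eq_mul, div_mul_cancel₀ _ h] at this
    exact lt_irrefl _ this
  have hF0 := (Submodule.disjoint_def.1 isCompl_annihilator_canonicalImage.disjoint) F hFann
    (htop ▸ Submodule.mem_top)
  rw [hF0] at hu
  exact (hu0.trans hu).false

theorem not_isLSummand :
    ¬ IsLSummand (StrongDual ℝ (StrongDual ℝ (StrongDual ℝ CZeroSumTwo)))
      (canonicalImage (StrongDual ℝ CZeroSumTwo)) := by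
  obtain ⟨φ, hφ⟩ := exists_notMem_canonicalImage
  have hinj : Function.Injective
      (NormedSpace.inclusionInDoubleDual ℝ (StrongDual ℝ CZeroSumTwo)) :=
    (NormedSpace.inclusionInDoubleDualLi (𝕜 := ℝ) (E := StrongDual ℝ CZeroSumTwo)).injective
  have hP := isL2Projection.transpose
  refine not_isLSummand_of_isL2Projection hP.transpose.transpose ?_ ?_ ?_
    (canonicalImage_strongDual_ne_top hφ)
  · rintro _ ⟨f, rfl⟩
    exact ⟨transpose (inl.comp fst) f, rfl⟩
  · refine ⟨_, ⟨(coord 0).comp fst, rfl⟩, fun h => ?_⟩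
    have h1 : transpose (inl.comp fst) ((coord 0).comp fst) = 0 := hinj (h.trans (map_zero _).symm)
    exact one_ne_zero ((unitVector_self 0).symm.trans (DFunLike.congr_fun h1 (inl (unitVector 0))))
  · refine ⟨_, ⟨(coord 0).comp snd, rfl⟩, fun h => ?_⟩
    have h1 : (coord 0).comp snd - transpose (inl.comp fst) ((coord 0).comp snd) = 0 := by
      refine hinj (Eq.trans ?_ (h.trans (map_zero _).symm))
      rw [map_sub]
      rfl
    have h2 := DFunLike.congr_fun h1 (inr (unitVector 0))
    refine one_ne_zero ((unitVector_self 0).symm.trans (Eq.trans ?_ h2))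
    exact (sub_zero _).symm

/-- Every unit vector `u` has a unit vector `v` violating the parallelogram inequality
`2 + 2 ‖v‖² ≤ ‖u + v‖² + ‖u - v‖²`, which the constant `1` of a uniform algebra satisfies. -/
theorem exists_norm_add_sq_add_norm_sub_sq_lt {u : CZeroSumTwo} (hu : ‖u‖ = 1) :
    ∃ v : CZeroSumTwo, ‖u + v‖ ^ 2 + ‖u - v‖ ^ 2 < 2 + 2 * ‖v‖ ^ 2 := by
  have hsmall : ∀ x : C₀(ℕ, ℝ), ∀ᶠ n in atTop, |x n| < 1 / 8 := fun x => by
    have := (tendsto_zero x).abs.eventually_lt_const (u := 1 / 8) (by norm_num)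
    exact this
  -- With `v` supported at such an `n` and having the component norms of `u`, both `‖u ± v‖²` are at
  -- most `1 + (‖fst u‖ + ‖snd u‖) / 4 + 1 / 32 < 2`, while the right-hand side is 4.
  obtain ⟨n, hn1, hn2⟩ := ((hsmall (fst u)).and (hsmall (snd u))).exists
  have hu2 := norm_sq u
  rw [hu, one_pow] at hu2
  have bound : ∀ σ : ℝ, |σ| = 1 → ‖u + (inl ((σ * ‖fst u‖) • unitVector n) +
      inr ((σ * ‖snd u‖) • unitVector n))‖ ^ 2 < 2 := by
    intro σ hσ
    have h1 := norm_add_smul_unitVector_le (fst u) n (c := σ * ‖fst u‖)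
      (by rw [abs_mul, hσ, one_mul, abs_norm])
    have h2 := norm_add_smul_unitVector_le (snd u) n (c := σ * ‖snd u‖)
      (by rw [abs_mul, hσ, one_mul, abs_norm])
    have h1' := pow_le_pow_left₀ (norm_nonneg _) (h1.trans (add_le_add_right hn1.le _)) 2
    have h2' := pow_le_pow_left₀ (norm_nonneg _) (h2.trans (add_le_add_right hn2.le _)) 2
    rw [norm_sq, map_add, map_add, map_add, map_add, fst_inl, fst_inr, snd_inl, snd_inr, add_zero,
      zero_add]
    nlinarith [sq_nonneg (‖fst u‖ - 1), sq_nonneg (‖snd u‖ - 1)]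
  refine ⟨inl (‖fst u‖ • unitVector n) + inr (‖snd u‖ • unitVector n), ?_⟩
  have hv : ‖inl (‖fst u‖ • unitVector n) + inr (‖snd u‖ • unitVector n)‖ ^ 2 = 1 := by
    rw [norm_sq, map_add, map_add, fst_inl, fst_inr, snd_inl, snd_inr, add_zero, zero_add,
      norm_smul_unitVector, norm_smul_unitVector, abs_norm, abs_norm, hu2]
  have b1 := bound 1 (by simp)
  have b2 := bound (-1) (by simp)
  rw [one_mul, one_mul] at b1
  rw [neg_one_mul, neg_one_mul, neg_smul, neg_smul, map_neg, map_neg, ← neg_add,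
    ← sub_eq_add_neg] at b2
  rw [hv]
  linarith

theorem not_isUniformAlgebra (𝕜 : Type) [RCLike 𝕜] : ¬ IsUniformAlgebra CZeroSumTwo 𝕜 := by
  rintro ⟨K, _, _, _, A, -, -, φ, hφ⟩
  obtain ⟨u, hu⟩ : (1 : C(K, 𝕜)) ∈ Set.range φ := hφ ▸ A.one_mem
  have hK : Nonempty K := by
    by_contra hK
    rw [not_nonempty_iff] at hK
    obtain ⟨P, -, ⟨y, hy⟩, -⟩ := hasNontrivialL2Projection
    exact hy (φ.injective (Subsingleton.elim _ _))
  have hu1 : ‖u‖ = 1 := by rw [← φ.norm_map, hu, norm_one]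
  obtain ⟨v, hv⟩ := exists_norm_add_sq_add_norm_sub_sq_lt hu1
  -- At a point where `|φ v|` attains its norm, the scalar parallelogram law bounds `‖u + v‖² + ‖u -
  -- v‖²` below by `2 + 2 ‖v‖²`.
  obtain ⟨k, -, hk⟩ := isCompact_univ.exists_isMaxOn Set.univ_nonempty
    (φ v).continuous.norm.continuousOn
  have hvk : ‖v‖ ≤ ‖φ v k‖ := by
    rw [← φ.norm_map]
    exact (ContinuousMap.norm_le _ (norm_nonneg _)).2 fun m => hk (Set.mem_univ m)
  have h1 : ‖1 + φ v k‖ ≤ ‖u + v‖ := by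
    rw [← φ.norm_map, map_add, hu]
    exact (1 + φ v).norm_coe_le_norm k
  have h2 : ‖1 - φ v k‖ ≤ ‖u - v‖ := by
    rw [← φ.norm_map, map_sub, hu]
    exact (1 - φ v).norm_coe_le_norm k
  have h3 := parallelogram_law_with_norm 𝕜 1 (φ v k)
  rw [norm_one] at h3
  have h1' := pow_le_pow_left₀ (norm_nonneg _) h1 2
  have h2' := pow_le_pow_left₀ (norm_nonneg _) h2 2
  have h3' := pow_le_pow_left₀ (norm_nonneg _) hvk 2
  nlinarith

/-- With `T` minus the projection onto one coordinate, `I + T` deletes that coordinate and is a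
contraction, although `T ≠ 0`. -/
theorem not_hasDaugavetProperty : ¬ HasDaugavetProperty CZeroSumTwo := by
  intro h
  set e : CZeroSumTwo := inl (unitVector 0)
  set T : CZeroSumTwo →L[ℝ] CZeroSumTwo := -((coord 0).comp fst).smulRight e with hT
  have hTx : ∀ x, T x = -(fst x 0 • e) := fun x => rfl
  have hTe : T e = -e := by
    rw [hTx, fst_inl, unitVector_self, one_smul]
  have he : e ≠ 0 := fun h0 => by
    have : unitVector 0 0 = 0 := DFunLike.congr_fun (congrArg fst h0) 0
    rw [unitVector_self] at this
    exact one_ne_zero this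
  have hrank : LinearMap.rank (T : CZeroSumTwo →ₗ[ℝ] CZeroSumTwo) = 1 := by
    refine rank_eq_one (⟨T e, ⟨e, rfl⟩⟩ : LinearMap.range (T : CZeroSumTwo →ₗ[ℝ] CZeroSumTwo)) ?_ ?_
    · intro h0
      have h1 : T e = 0 := congrArg Subtype.val h0
      rw [hTe, neg_eq_zero] at h1
      exact he h1
    · rintro ⟨_, x, rfl⟩
      refine ⟨fst x 0, Subtype.ext ?_⟩
      change fst x 0 • T e = T x
      rw [hTe, hTx, smul_neg]
  have hle : ‖ContinuousLinearMap.id ℝ CZeroSumTwo + T‖ ≤ 1 := by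
    refine ContinuousLinearMap.opNorm_le_bound _ zero_le_one fun x => ?_
    rw [one_mul]
    change ‖x + T x‖ ≤ ‖x‖
    rw [hTx]
    apply norm_le_of_fst_snd
    · have := norm_replace_le (fst x) 0 (c := 0) le_rfl (by simp)
      simpa [e] using this
    · simp [e]
  have hpos : 0 < ‖T‖ := by
    rw [norm_pos_iff]
    intro h0
    rw [h0] at hTe
    exact he (neg_eq_zero.1 hTe.symm)
  rw [h T hrank] at hle
  linarith

end CZeroSumTwo

end

theorem mainTheorem7 :
    IsStrictUIdealInBidual CZeroSumTwo ∧
    HasDiameterTwoProperty CZeroSumTwo ∧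
    ¬ IsLSummand (StrongDual ℝ (StrongDual ℝ (StrongDual ℝ CZeroSumTwo)))
      (canonicalImage (StrongDual ℝ CZeroSumTwo)) ∧
    (⨆ n : ℕ, Module.rank ℝ (centralizer (evenDual CZeroSumTwo n).carrier)) = 1 ∧
    (¬ IsUniformAlgebra CZeroSumTwo ℝ ∧ ¬ IsUniformAlgebra CZeroSumTwo ℂ) ∧
    ¬ HasDaugavetProperty CZeroSumTwo := by
  refine ⟨CZeroSumTwo.isStrictUIdealInBidual, CZeroSumTwo.hasDiameterTwoProperty,
    CZeroSumTwo.not_isLSummand, ?_,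
    ⟨CZeroSumTwo.not_isUniformAlgebra ℝ, CZeroSumTwo.not_isUniformAlgebra ℂ⟩,
    CZeroSumTwo.not_hasDaugavetProperty⟩
  simp only [(CZeroSumTwo.hasNontrivialL2Projection.evenDual _).rank_centralizer, ciSup_const]
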